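/- All graphs are finite. An edge of a graph $G$ is called lonely if it belongs to exactly one perfect matching of $G$, and $l(G)$ denotes the number of lonely edges of $G$. Let $\mathcal{U}$ be the class of $3$-connected cubic graphs that have at least one lonely edge (such graphs are automatically simple). For a cubic graph $G$ and a vertex $v$ of $G$ with neighbours $x_1,x_2,x_3$, let $G^v$ be the cubic graph obtained from $G$ by replacing $v$ with a triangle, i.e. $V(G^v)=(V(G)\setminus\{v\})\cup\{v_1,v_2,v_3\}$, where $v_1,v_2,v_3$ are new vertices, and $E(G^v)=(E(G)\setminus\{vx_1,vx_2,vx_3\})\cup\{v_1x_1,v_2x_2,v_3x_3\}\cup\{v_1v_2,v_2v_3,v_3v_1\}$. A $v$-join of $G$ is a spanning subgraph of $G$ in which $v$ has degree $3$ and every other vertex has degree $1$. Corollary. For every $G\in\mathcal{U}$ and every $v\in V(G)$, $$l(G^v)=l(G)-p_v,$$ where $p_v$ is the number of lonely edges of $G$ that are not incident with $v$ and are contained in some $v$-join of $G$. -/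

import Mathlib

namespace LonelyEdges

variable {V : Type*}

/-- An edge is lonely if it belongs to exactly one perfect matching. -/
def IsLonely (G : SimpleGraph V) (e : Sym2 V) : Prop :=
  e ∈ G.edgeSet ∧ ∃! M : G.Subgraph, M.IsPerfectMatching ∧ e ∈ M.edgeSet

/-- `l(G)`, the number of lonely edges of `G`. -/
noncomputable def lonelyCount (G : SimpleGraph V) : ℕ :=
  {e : Sym2 V | IsLonely G e}.ncard

/-- (Vertex) 3-connectedness: more than three vertices, and the deletion of fewer than three
vertices never disconnects the graph. -/
def IsThreeConnected [Fintype V] (G : SimpleGraph V) : Prop :=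
  3 < Fintype.card V ∧
    ∀ S : Finset V, S.card < 3 → (G.induce ((S : Set V)ᶜ)).Connected

/-- The class `𝒰` of 3-connected cubic graphs having at least one lonely edge. No generality is
lost by using simple graphs: a cubic multigraph with a loop or a parallel edge is not
3-connected. -/
structure ClassU [Fintype V] (G : SimpleGraph V) [DecidableRel G.Adj] : Prop where
  cubic : G.IsRegularOfDegree 3
  threeConnected : IsThreeConnected G
  exists_lonely : ∃ e, IsLonely G e

/-- The graph `G^v`, in which `v` is replaced with a triangle. Its vertices are the vertices of `G`
other than `v`, together with one new vertex `v_x` for each neighbour `x` of `v` in `G`. -/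
abbrev ExpandVertex (G : SimpleGraph V) (v : V) : Type _ :=
  {w : V // w ≠ v} ⊕ G.neighborSet v

/-- Adjacency in `G^v`: the edges of `G` not incident with `v` are kept, every edge `vx` becomes
`v_x x`, and any two distinct new vertices are joined (a triangle, as `v` has degree three). -/
def expandAdj (G : SimpleGraph V) (v : V) : ExpandVertex G v → ExpandVertex G v → Prop
  | .inl a, .inl b => G.Adj a b
  | .inl a, .inr x => (a : V) = x
  | .inr x, .inl a => (a : V) = x
  | .inr x, .inr y => x ≠ y

/-- The graph `G^v`. -/
def expand (G : SimpleGraph V) (v : V) : SimpleGraph (ExpandVertex G v) where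
  Adj := expandAdj G v
  symm := ⟨by
    rintro (a | x) (b | y) h
    · exact G.adj_symm h
    · exact h
    · exact h
    · exact Ne.symm h⟩
  loopless := ⟨by
    rintro (a | x) h
    · exact G.irrefl h
    · exact h rfl⟩

/-- A `v`-join of `G`: a spanning subgraph in which `v` has degree 3 and every other vertex has
degree 1. -/
def IsJoin (G : SimpleGraph V) (v : V) (J : G.Subgraph) : Prop :=
  J.IsSpanning ∧ (J.neighborSet v).ncard = 3 ∧ ∀ w, w ≠ v → (J.neighborSet w).ncard = 1

/-- `p_v`, the number of lonely edges of `G` not incident with `v` which are contained in some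
`v`-join of `G`. -/
noncomputable def joinLonelyCount (G : SimpleGraph V) (v : V) : ℕ :=
  {e : Sym2 V | IsLonely G e ∧ v ∉ e ∧ ∃ J : G.Subgraph, IsJoin G v J ∧ e ∈ J.edgeSet}.ncard

end LonelyEdges

/-!
By parity and bridgelessness every odd set of vertices of `G` is left by at least three edges: `G`
is an `r`-graph in the sense of Seymour with `r = 3`. Contracting the triangle turns the perfect
matchings of `G^v` into the perfect matchings and the `v`-joins of `G`, bijectively. Hence an edge
of `G` which survives in `G^v` is lonely there iff it is lonely in `G` and lies in no `v`-join, and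
the triangle edge `v_y v_z` is lonely iff `vx` is, where `x` is the third neighbour of `v`.

The formula thus amounts to the edges `v_x x` never being lonely in `G^v`. If there is a `v`-join,
it contains `vx`, as does some perfect matching. If there is none, Tutte's theorem provides a set
`T` and `|T|` disjoint odd sets, each separated by `T` from everything else, one of which is `{v}`.
All edges at `T` then lead to these sets, and every choice of partners matching `T` with the odd
sets extends to a perfect matching, because each odd set behaves like a single vertex. Rerouting
along a cycle that avoids `v` produces a second perfect matching through `vx`.
-/

namespace LonelyEdges

open Finset SimpleGraph

section Interedges

variable {V : Type*} {G : SimpleGraph V} [DecidableRel G.Adj]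

lemma card_interedges_comm (X Y : Finset V) : #(G.interedges X Y) = #(G.interedges Y X) :=
  have : Std.Symm G.Adj := G.symm
  Rel.card_interedges_comm X Y

lemma card_interedges_le_of_adj {X Y Z : Finset V} (h : ∀ x ∈ X, ∀ y ∈ Y, G.Adj x y → y ∈ Z) :
    #(G.interedges X Y) ≤ #(G.interedges X Z) := by
  refine card_le_card fun p hp ↦ ?_
  rw [mem_interedges_iff] at hp ⊢
  exact ⟨hp.1, h _ hp.1 _ hp.2.1 hp.2.2, hp.2.2⟩

lemma even_card_interedges_self (X : Finset V) : Even #(G.interedges X X) := by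
  have hsum := sum_involution (s := G.interedges X X) (f := fun _ ↦ (1 : ZMod 2))
    (fun p _ ↦ p.swap) (fun _ _ ↦ by decide)
    (fun p hp _ hswap ↦ G.ne_of_adj ((G.mem_interedges_iff).1 hp).2.2 (congrArg Prod.snd hswap))
    (fun _ hp ↦ (swap_mem_interedges_iff G).2 hp) (fun p _ ↦ p.swap_swap)
  rwa [sum_const, nsmul_one, ZMod.natCast_eq_zero_iff_even] at hsum

lemma card_interedges_univ [Fintype V] {d : ℕ} (hG : G.IsRegularOfDegree d) (X : Finset V) :
    #(G.interedges X univ) = d * #X := by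
  have hsum : #(G.interedges X univ) = ∑ x ∈ X, G.degree x := by
    simp only [interedges_def, card_filter, sum_product, ← card_neighborFinset_eq_degree,
      neighborFinset_eq_filter]
  simp only [hsum, hG.degree_eq, sum_const, smul_eq_mul, mul_comm]

variable [DecidableEq V]

lemma card_interedges_biUnion_left {ι : Type*} {s : Finset ι} {f : ι → Finset V}
    (hf : (s : Set ι).PairwiseDisjoint f) (Y : Finset V) :
    #(G.interedges (s.biUnion f) Y) = ∑ i ∈ s, #(G.interedges (f i) Y) := by
  rw [interedges_biUnion_left, card_biUnion]
  exact fun i hi j hj hij ↦ interedges_disjoint_left _ (hf hi hj hij) Y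

lemma card_interedges_union_right (X : Finset V) {Y Z : Finset V} (hYZ : Disjoint Y Z) :
    #(G.interedges X (Y ∪ Z)) = #(G.interedges X Y) + #(G.interedges X Z) := by
  have hunion : G.interedges X (Y ∪ Z) = G.interedges X Y ∪ G.interedges X Z := by
    ext; simp only [mem_interedges_iff, mem_union]; tauto
  rw [hunion, card_union_of_disjoint (interedges_disjoint_right _ X hYZ)]

lemma card_interedges_add_compl [Fintype V] (X Y : Finset V) :
    #(G.interedges X Y) + #(G.interedges X Yᶜ) = #(G.interedges X univ) := by
  rw [← card_interedges_union_right X disjoint_compl_right, union_compl]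

end Interedges

section RGraph

variable {V : Type*} [Fintype V] [DecidableEq V] {G : SimpleGraph V} [DecidableRel G.Adj] {r : ℕ}

/-- The `r`-graphs of Seymour: `r`-regular graphs in which every odd set of vertices is left by at
least `r` edges. An odd set left by exactly `r` edges behaves in them like a single vertex. -/
structure IsRGraph (G : SimpleGraph V) [DecidableRel G.Adj] (r : ℕ) : Prop where
  regular : G.IsRegularOfDegree r
  le_card_interedges_compl : ∀ A : Finset V, Odd #A → r ≤ #(G.interedges A Aᶜ)

lemma IsRGraph.ncard_neighborSet (hG : IsRGraph G r) (v : V) :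
    (G.neighborSet v).ncard = r := by
  rw [Set.ncard_eq_toFinset_card', ← neighborFinset_def, card_neighborFinset_eq_degree,
    hG.regular.degree_eq]

lemma IsRGraph.even_card (hG : IsRGraph G r) (hr : 0 < r) : Even (Fintype.card V) := by
  by_contra hodd
  have hcut := hG.le_card_interedges_compl univ (Nat.not_even_iff_odd.mp hodd)
  simp only [compl_univ, interedges_def, product_empty, filter_empty, card_empty] at hcut
  omega

lemma isBridge_of_interedges_compl_eq_singleton {A : Finset V} {a b : V}
    (hA : G.interedges A Aᶜ = {(a, b)}) : G.IsBridge s(a, b) := by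
  have hab : (a, b) ∈ G.interedges A Aᶜ := hA ▸ mem_singleton_self _
  rw [mk_mem_interedges_iff, mem_compl] at hab
  rw [isBridge_iff]
  rintro ⟨p⟩
  obtain ⟨d, -, hd, hd'⟩ := p.exists_boundary_dart A hab.1 hab.2.1
  have hadj := (deleteEdges_adj.mp d.adj)
  have hcut : (d.fst, d.snd) ∈ G.interedges A Aᶜ :=
    (G.mk_mem_interedges_iff).mpr ⟨hd, mem_compl.mpr hd', hadj.1⟩
  rw [hA, mem_singleton, Prod.mk.injEq] at hcut
  exact hadj.2 (by rw [hcut.1, hcut.2]; rfl)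

lemma isRGraph_three_of_forall_not_isBridge (hG : G.IsRegularOfDegree 3)
    (hbridge : ∀ e ∈ G.edgeSet, ¬ G.IsBridge e) : IsRGraph G 3 where
  regular := hG
  le_card_interedges_compl A hA := by
    have hodd : Odd #(G.interedges A Aᶜ) := by
      have hsum := card_interedges_add_compl (G := G) A A
      rw [card_interedges_univ hG] at hsum
      grind [even_card_interedges_self (G := G) A]
    suffices hne : #(G.interedges A Aᶜ) ≠ 1 by
      obtain ⟨k, hk⟩ := hodd
      omega
    intro hone
    obtain ⟨⟨a, b⟩, hab⟩ := card_eq_one.mp hone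
    have hadj : (a, b) ∈ G.interedges A Aᶜ := hab ▸ mem_singleton_self _
    exact hbridge s(a, b) (G.mk_mem_interedges_iff.mp hadj).2.2
      (isBridge_of_interedges_compl_eq_singleton hab)

end RGraph

section Tutte

variable {V : Type*} {G : SimpleGraph V}

/-- `𝒞` is a family of disjoint odd sets, each of which is a union of components of `G - T`. Taking
for `𝒞` the odd components of `G - T` recovers the certificates of Tutte's theorem. -/
structure SeparatesOddSets (G : SimpleGraph V) (T : Finset V) (𝒞 : Finset (Finset V)) : Prop where
  odd_card : ∀ C ∈ 𝒞, Odd #C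
  disjoint : ∀ C ∈ 𝒞, Disjoint C T
  mem_or_mem : ∀ C ∈ 𝒞, ∀ a ∈ C, ∀ b, G.Adj a b → b ∈ C ∨ b ∈ T
  pairwiseDisjoint : (𝒞 : Set (Finset V)).PairwiseDisjoint id

lemma SeparatesOddSets.mem_of_adj_of_singleton_mem {T : Finset V} {𝒞 : Finset (Finset V)}
    (h : SeparatesOddSets G T 𝒞) {v x : V} (hv : {v} ∈ 𝒞) (hvx : G.Adj v x) :
    x ∈ T :=
  (h.mem_or_mem _ hv v (mem_singleton_self v) x hvx).resolve_left (by simpa using hvx.ne')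

variable [Fintype V] [DecidableEq V]

lemma exists_separatesOddSets_of_embedding {W : Type*} [Fintype W] {H : SimpleGraph W}
    (f : H ↪g G) :
    ∃ 𝒞, SeparatesOddSets G (univ.map f.toEmbedding)ᶜ 𝒞 ∧ #𝒞 = H.oddComponents.ncard := by
  classical
  let image (c : H.ConnectedComponent) : Finset V := c.supp.toFinset.map f.toEmbedding
  have mem_image {c : H.ConnectedComponent} {a : V} :
      a ∈ image c ↔ ∃ w, H.connectedComponentMk w = c ∧ f w = a := by simp [image]
  have injective_image : Function.Injective image := fun c d hcd ↦
    ConnectedComponent.supp_injective (Set.toFinset_inj.mp (map_injective _ hcd))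
  refine ⟨H.oddComponents.toFinset.map ⟨image, injective_image⟩, ⟨?_, ?_, ?_, ?_⟩, ?_⟩
  · simp [image, Set.ncard_eq_toFinset_card']
  · simp +contextual [Finset.disjoint_left, image]
  · simp only [mem_map, Function.Embedding.coeFn_mk, forall_exists_index, and_imp]
    rintro _ c - rfl a ha b hab
    obtain ⟨w, rfl, rfl⟩ := mem_image.mp ha
    by_cases hb : ∃ w', f w' = b
    · obtain ⟨w', rfl⟩ := hb
      exact .inl (mem_image.mpr
        ⟨w', (ConnectedComponent.connectedComponentMk_eq_of_adj (f.map_adj_iff.mp hab)).symm, rfl⟩)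
    · exact .inr (by simpa using hb)
  · rw [coe_map]
    rintro _ ⟨c, -, rfl⟩ _ ⟨d, -, rfl⟩ hcd
    simp only [Function.onFun, id, Finset.disjoint_left, Function.Embedding.coeFn_mk, mem_image]
    rintro _ ⟨w, rfl, rfl⟩ ⟨w', rfl, hw'⟩
    exact hcd (by rw [f.injective hw'])
  · rw [card_map, Set.ncard_eq_toFinset_card']

lemma exists_separatesOddSets_of_forall_not_isMatching (X : Finset V) (heven : Even #Xᶜ)
    (hX : ∀ M : G.Subgraph, M.IsMatching → M.verts ≠ ↑Xᶜ) :
    ∃ T 𝒞, X ⊆ T ∧ SeparatesOddSets G T 𝒞 ∧ #T + 2 ≤ #𝒞 + #X := by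
  classical
  let H := G.induce (↑Xᶜ : Set V)
  obtain ⟨u, hu⟩ : ∃ u, H.IsTutteViolator u := by
    by_contra! hno
    obtain ⟨M, hM, hMspan⟩ := tutte.mpr hno
    refine hX _ (hM.map (Embedding.induce _).toHom Subtype.val_injective) ?_
    ext; simp [Subgraph.isSpanning_iff.mp hMspan]
  let K := ((⊤ : H.Subgraph).deleteVerts u).coe
  let f : K ↪g G := ⟨⟨fun w ↦ w.1.1, Subtype.val_injective.comp Subtype.val_injective⟩,
    fun {a b} ↦ by simp [K, H, a.2.2, b.2.2]⟩
  obtain ⟨𝒞, h𝒞, hcard⟩ := exists_separatesOddSets_of_embedding f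
  refine ⟨_, 𝒞, fun x hx ↦ ?_, h𝒞, ?_⟩
  · simp +contextual [f, hx]
  · have hparity := K.odd_ncard_oddComponents
    have hverts : u.ncard + Nat.card ((⊤ : H.Subgraph).deleteVerts u).verts = #Xᶜ := by
      rw [Subgraph.deleteVerts_verts, Subgraph.verts_top, ← Set.compl_eq_univ_sdiff,
        Nat.card_coe_set_eq, Set.ncard_add_ncard_compl, Nat.card_eq_fintype_card]
      simp only [Fintype.card_coe, coe_sort_coe]
    have hlt : u.ncard < #𝒞 := hcard ▸ hu
    have hX := X.card_compl_add_card
    rw [← hcard, Nat.card_eq_fintype_card] at hparity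
    rw [Nat.card_eq_fintype_card] at hverts
    rw [card_compl, card_map, card_univ]
    grind

end Tutte

section SeparationInRGraph

variable {V : Type*} [Fintype V] [DecidableEq V] {G : SimpleGraph V} [DecidableRel G.Adj] {r : ℕ}
  {T : Finset V} {𝒞 : Finset (Finset V)}

lemma SeparatesOddSets.le_card_interedges (h : SeparatesOddSets G T 𝒞) (hG : IsRGraph G r)
    {C : Finset V} (hC : C ∈ 𝒞) : r ≤ #(G.interedges C T) :=
  (hG.le_card_interedges_compl C (h.odd_card C hC)).trans <|
    card_interedges_le_of_adj fun a ha b hb hab ↦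
      (h.mem_or_mem C hC a ha b hab).resolve_left (mem_compl.mp hb)

lemma SeparatesOddSets.mul_card_le_card_interedges (h : SeparatesOddSets G T 𝒞)
    (hG : IsRGraph G r) : r * #𝒞 ≤ #(G.interedges T (𝒞.biUnion id)) := by
  rw [card_interedges_comm, card_interedges_biUnion_left h.pairwiseDisjoint, mul_comm]
  exact card_nsmul_le_sum _ _ _ fun C hC ↦ h.le_card_interedges hG hC

lemma SeparatesOddSets.mul_card_add_card_interedges_le (h : SeparatesOddSets G T 𝒞)
    (hG : IsRGraph G r) :
    r * #𝒞 + #(G.interedges T (𝒞.biUnion id)ᶜ) ≤ r * #T := by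
  rw [← card_interedges_univ hG.regular, ← card_interedges_add_compl T (𝒞.biUnion id)]
  exact Nat.add_le_add_right (h.mul_card_le_card_interedges hG) _

lemma SeparatesOddSets.exists_mem_of_adj (h : SeparatesOddSets G T 𝒞) (hG : IsRGraph G r)
    (htight : #T ≤ #𝒞) {t a : V} (ht : t ∈ T) (hta : G.Adj t a) : ∃ C ∈ 𝒞, a ∈ C := by
  by_contra! hno
  have hedge : (t, a) ∈ G.interedges T (𝒞.biUnion id)ᶜ :=
    (mk_mem_interedges_iff G).mpr ⟨ht, by simpa using hno, hta⟩
  have hpos := card_pos.mpr ⟨_, hedge⟩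
  have hle := h.mul_card_add_card_interedges_le hG
  have hmul := Nat.mul_le_mul_left r htight
  omega

lemma SeparatesOddSets.card_interedges_compl_le (h : SeparatesOddSets G T 𝒞) (hG : IsRGraph G r)
    (htight : #T ≤ #𝒞) {C : Finset V} (hC : C ∈ 𝒞) : #(G.interedges C Cᶜ) ≤ r := by
  have hsum : ∑ D ∈ 𝒞, #(G.interedges D T) ≤ ∑ _D ∈ 𝒞, r := calc
    ∑ D ∈ 𝒞, #(G.interedges D T) = #(G.interedges T (𝒞.biUnion id)) := by
      rw [card_interedges_comm, card_interedges_biUnion_left h.pairwiseDisjoint]; rfl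
    _ ≤ #(G.interedges T univ) := card_interedges_le_of_adj fun _ _ _ _ _ ↦ mem_univ _
    _ = r * #T := card_interedges_univ hG.regular T
    _ ≤ ∑ _D ∈ 𝒞, r := by rw [sum_const, smul_eq_mul, mul_comm]; gcongr
  have hle : ∀ D ∈ 𝒞, r ≤ #(G.interedges D T) := fun D hD ↦ h.le_card_interedges hG hD
  rw [(sum_eq_sum_iff_of_le hle).mp ((sum_le_sum hle).antisymm hsum) C hC]
  exact card_interedges_le_of_adj fun a ha b hb hab ↦
    (h.mem_or_mem C hC a ha b hab).resolve_left (mem_compl.mp hb)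

lemma SeparatesOddSets.card_add_card_compl_le (h : SeparatesOddSets G T 𝒞) (hG : IsRGraph G r)
    {A : Finset V} (hcut : #(G.interedges A Aᶜ) ≤ r) (hAT : Aᶜ ⊆ T) {a b : V} (ha : a ∈ A)
    (haT : a ∈ T) (hb : b ∉ A) (hab : G.Adj a b) : #𝒞 + #Aᶜ ≤ #T := by
  set U := 𝒞.biUnion id
  have hUT : Disjoint U T := (disjoint_biUnion_left _ _ _).mpr h.disjoint
  have hT : Aᶜ ∪ (T \ Aᶜ) = T := union_sdiff_of_subset hAT
  have hTU : #(G.interedges T U) = #(G.interedges Aᶜ U) + #(G.interedges (T \ Aᶜ) U) := by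
    simp only [card_interedges_comm _ U]
    rw [← card_interedges_union_right U disjoint_sdiff, hT]
  have hAcU : #(G.interedges Aᶜ (T \ Aᶜ)) + #(G.interedges Aᶜ U) ≤ r := by
    rw [← card_interedges_union_right _ (hUT.symm.mono_left sdiff_subset)]
    rw [card_interedges_comm] at hcut
    refine (card_interedges_le_of_adj fun _ _ x hx _ ↦ ?_).trans hcut
    by_contra hxA
    rcases mem_union.mp hx with hxS | hxU
    · exact (mem_sdiff.mp hxS).2 (mem_compl.mpr hxA)
    · exact Finset.disjoint_left.mp hUT hxU (hAT (mem_compl.mpr hxA))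
  have hSU : #(G.interedges (T \ Aᶜ) Aᶜ) + #(G.interedges (T \ Aᶜ) U) ≤ r * #(T \ Aᶜ) := by
    rw [← card_interedges_univ hG.regular,
      ← card_interedges_union_right _ (hUT.symm.mono_left hAT)]
    exact card_interedges_le_of_adj fun _ _ _ _ _ ↦ mem_univ _
  have hpos : 0 < #(G.interedges (T \ Aᶜ) Aᶜ) :=
    card_pos.mpr ⟨(a, b), (mk_mem_interedges_iff G).mpr (by simp [*])⟩
  rw [card_interedges_comm] at hAcU
  have hlt : r * #𝒞 < r * (#(T \ Aᶜ) + 1) := by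
    have := h.mul_card_le_card_interedges hG
    grind
  have := Nat.lt_of_mul_lt_mul_left hlt
  have := card_sdiff_add_card_eq_card hAT
  omega

lemma IsRGraph.exists_isMatching_verts_eq_insert (hG : IsRGraph G r) {A : Finset V}
    (hA : Odd #A) (hcut : #(G.interedges A Aᶜ) ≤ r) {a b : V} (ha : a ∈ A) (hb : b ∉ A)
    (hba : G.Adj b a) : ∃ M : G.Subgraph, M.IsMatching ∧ M.verts = ↑(insert b A) ∧ M.Adj b a := by
  by_contra! hno
  have hcompl : (insert a Aᶜ)ᶜ = A.erase a := by ext; simp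
  obtain ⟨T, 𝒞, hT, h, hcard⟩ : ∃ T 𝒞, insert a Aᶜ ⊆ T ∧ SeparatesOddSets G T 𝒞 ∧
      #T + 2 ≤ #𝒞 + #(insert a Aᶜ) := by
    refine exists_separatesOddSets_of_forall_not_isMatching _ ?_ fun M hM hverts ↦ ?_
    · rw [hcompl, card_erase_of_mem ha]
      exact Nat.Odd.sub_odd hA odd_one
    · rw [hcompl] at hverts
      have hdisj : Disjoint M.support (G.subgraphOfAdj hba).support := by
        rw [hM.support_eq_verts, (Subgraph.IsMatching.subgraphOfAdj hba).support_eq_verts, hverts,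
          Set.disjoint_left]
        rintro x hx (rfl | rfl)
        · exact hb (mem_of_mem_erase hx)
        · exact notMem_erase _ _ hx
      refine hno _ (hM.sup (.subgraphOfAdj hba) hdisj) ?_ (by simp)
      rw [Subgraph.verts_sup, hverts, subgraphOfAdj_verts, Set.union_insert, coe_erase,
        Set.sdiff_union_self, Set.union_eq_self_of_subset_right (by simpa), coe_insert]
  have := h.card_add_card_compl_le hG hcut ((subset_insert _ _).trans hT) ha
    (hT (mem_insert_self _ _)) hb hba.symm
  rw [card_insert_of_notMem (by simpa)] at hcard
  omega

lemma IsRGraph.exists_isPerfectMatching_adj (hG : IsRGraph G r) {a b : V} (hba : G.Adj b a) :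
    ∃ M : G.Subgraph, M.IsPerfectMatching ∧ M.Adj b a := by
  have hr : 0 < r := hG.regular.degree_eq b ▸ (G.degree_pos_iff_exists_adj b).mpr ⟨a, hba⟩
  have hodd : Odd #({b}ᶜ : Finset V) := by
    rw [card_compl, card_singleton]
    exact Nat.Even.sub_odd (Fintype.card_pos_iff.mpr ⟨b⟩) (hG.even_card hr) odd_one
  have hcut : #(G.interedges ({b}ᶜ : Finset V) {b}ᶜᶜ) ≤ r := by
    rw [compl_compl, card_interedges_comm, ← mul_one r, ← card_singleton b,
      ← card_interedges_univ hG.regular]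
    exact card_interedges_le_of_adj fun _ _ _ _ _ ↦ mem_univ _
  obtain ⟨M, hM, hverts, hadj⟩ :=
    hG.exists_isMatching_verts_eq_insert hodd hcut (by simpa using hba.ne') (by simp) hba
  exact ⟨M, ⟨hM, Subgraph.isSpanning_iff.mpr (by simp [hverts])⟩, hadj⟩

end SeparationInRGraph

lemma exists_adj_notMem_of_card_lt_degree {V : Type*} {G : SimpleGraph V} {v : V}
    [Fintype (G.neighborSet v)] {S : Finset V} (hS : #S < G.degree v) :
    ∃ a ∉ S, G.Adj v a := by
  rw [← card_neighborFinset_eq_degree] at hS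
  obtain ⟨a, hva, ha⟩ := exists_mem_notMem_of_card_lt_card hS
  exact ⟨a, ha, (G.mem_neighborFinset v a).mp hva⟩

lemma exists_nonempty_subset_bijOn_self {α : Type*} {S : Finset α} {φ : α → α}
    (hS : S.Nonempty) (hφ : Set.MapsTo φ S S) : ∃ P ⊆ S, P.Nonempty ∧ Set.BijOn φ P P := by
  classical
  obtain ⟨P, hPS, ⟨hPne, hPφ⟩, hPmin⟩ := exists_minimal_le_of_wellFoundedLT
    (fun P : Finset α ↦ P.Nonempty ∧ Set.MapsTo φ P P) S ⟨hS, hφ⟩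
  have himage_sub : P.image φ ⊆ P := image_subset_iff.mpr hPφ
  have himage : P.image φ = P := himage_sub.antisymm <| hPmin
    ⟨hPne.image φ, fun y hy ↦ mem_image_of_mem φ (himage_sub hy)⟩ himage_sub
  refine ⟨P, hPS, hPne, hPφ, injOn_of_card_image_eq (by rw [himage]), ?_⟩
  rw [Set.SurjOn, ← coe_image, himage]

lemma bijOn_piecewise_id {α : Type*} [DecidableEq α] {P S : Finset α} {φ : α → α} (hPS : P ⊆ S)
    (hφ : Set.BijOn φ P P) : Set.BijOn (P.piecewise φ id) S S := by
  have hmem : Set.BijOn (P.piecewise φ id) P P :=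
    hφ.congr fun t ht ↦ (piecewise_eq_of_mem _ _ _ ht).symm
  have hnotMem : Set.BijOn (P.piecewise φ id) (S \ P) (S \ P) :=
    (Set.bijOn_id _).congr fun t ht ↦ (piecewise_eq_of_notMem _ _ _ ht.2).symm
  rw [← Set.union_sdiff_cancel (coe_subset.mpr hPS)]
  refine hmem.union hnotMem ((Set.injOn_union Set.disjoint_sdiff_right).mpr
    ⟨hmem.injOn, hnotMem.injOn, fun s hs t ht heq ↦ ?_⟩)
  exact (hnotMem.mapsTo ht).2 (heq ▸ hmem.mapsTo hs)

section GluingMatchings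

variable {V : Type*} {G : SimpleGraph V}

lemma isMatching_induce {M : G.Subgraph} (hM : M.IsMatching) {X : Set V} (hX : X ⊆ M.verts)
    (hclosed : ∀ a ∈ X, ∀ b, M.Adj a b → b ∈ X) : (M.induce X).IsMatching := by
  intro a ha
  obtain ⟨b, hab, hb⟩ := hM (hX ha)
  exact ⟨b, ⟨ha, hclosed a ha b hab, hab⟩, fun c hc ↦ hb c hc.2.2⟩

lemma exists_adj_notMem_of_odd_card {M : G.Subgraph} (hM : M.IsPerfectMatching) {C : Finset V}
    (hC : Odd #C) : ∃ a ∈ C, ∃ b ∉ C, M.Adj a b := by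
  by_contra! hclosed
  have hM' := isMatching_induce hM.1 (X := C) (fun a _ ↦ hM.2 a)
    fun a ha b hab ↦ by_contra fun hb ↦ hclosed a ha b hb hab
  let : Fintype (M.induce (C : Set V)).verts := inferInstanceAs (Fintype (C : Set V))
  have heven := hM'.even_card
  rw [Set.toFinset_card] at heven
  exact Nat.not_even_iff_odd.mpr hC (Fintype.card_coe C ▸ heven)

variable [Fintype V] [DecidableEq V] [DecidableRel G.Adj] {r : ℕ}
  {T : Finset V} {𝒞 : Finset (Finset V)}

lemma SeparatesOddSets.exists_bijOn_of_isPerfectMatching (h : SeparatesOddSets G T 𝒞)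
    (hG : IsRGraph G r) (htight : #T ≤ #𝒞) {M : G.Subgraph} (hM : M.IsPerfectMatching) :
    ∃ c : V → Finset V, Set.BijOn c T 𝒞 ∧ ∀ t ∈ T, ∀ a, M.Adj t a → a ∈ c t := by
  choose p hp hp_unique using Subgraph.isPerfectMatching_iff.mp hM
  choose! c hc𝒞 hpc using fun t ht ↦ h.exists_mem_of_adj hG htight ht (hp t).adj_sub
  have hsurj : Set.SurjOn c T 𝒞 := by
    intro C hC
    obtain ⟨a, ha, t, ht, hat⟩ := exists_adj_notMem_of_odd_card hM (h.odd_card C hC)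
    have htT : t ∈ T := (h.mem_or_mem C hC a ha t hat.adj_sub).resolve_left ht
    have hpt : p t = a := (hp_unique t a hat.symm).symm
    exact ⟨t, htT, h.pairwiseDisjoint.elim_finset (hc𝒞 t htT) hC a (hpt ▸ hpc t htT) ha⟩
  exact ⟨c, ⟨hc𝒞, injOn_of_surjOn_of_card_le c hc𝒞 hsurj htight, hsurj⟩,
    fun t ht a hta ↦ hp_unique t a hta ▸ hpc t ht⟩

lemma SeparatesOddSets.exists_isMatching_of_bijOn (h : SeparatesOddSets G T 𝒞)
    (hG : IsRGraph G r) (htight : #T ≤ #𝒞) {c : V → Finset V} (hc : Set.BijOn c T 𝒞)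
    {p : V → V} (hpc : ∀ t ∈ T, p t ∈ c t) (hp : ∀ t ∈ T, G.Adj t (p t)) :
    ∃ M : G.Subgraph, M.IsMatching ∧ M.verts = ↑(T ∪ 𝒞.biUnion id) ∧ ∀ t ∈ T, M.Adj t (p t) := by
  have hTc : ∀ s ∈ T, ∀ t ∈ T, s ∉ c t := fun s hs t ht hst ↦
    Finset.disjoint_left.mp (h.disjoint _ (hc.mapsTo ht)) hst hs
  have hN (t : T) := hG.exists_isMatching_verts_eq_insert (h.odd_card _ (hc.mapsTo t.2))
    (h.card_interedges_compl_le hG htight (hc.mapsTo t.2)) (hpc t t.2) (hTc t t.2 t t.2) (hp t t.2)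
  choose N hN hverts hadj using hN
  refine ⟨⨆ t, N t, .iSup hN fun s t hst ↦ ?_, ?_, fun t ht ↦ ?_⟩
  · have hcst := h.pairwiseDisjoint (hc.mapsTo s.2) (hc.mapsTo t.2)
      (fun heq ↦ hst (Subtype.ext (hc.injOn s.2 t.2 heq)))
    change Disjoint (N s).support (N t).support
    rw [(hN s).support_eq_verts, (hN t).support_eq_verts, hverts, hverts, disjoint_coe,
      disjoint_insert_left, disjoint_insert_right]
    have hne : (t : V) ≠ s := fun heq ↦ hst (Subtype.ext heq.symm)
    exact ⟨by simp [hne.symm, hTc _ s.2 _ t.2], hTc _ t.2 _ s.2, hcst⟩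
  · have h𝒞 : 𝒞 = T.image c := coe_injective (by rw [coe_image, hc.image_eq])
    ext a
    simp only [h𝒞, Subgraph.verts_iSup, hverts, coe_insert, Set.mem_iUnion, Set.mem_insert_iff,
      SetLike.mem_coe, Subtype.exists, mem_union, mem_biUnion, mem_image, id_eq,
      exists_exists_and_eq_and]
    grind
  · exact Subgraph.iSup_adj.mpr ⟨⟨t, ht⟩, hadj ⟨t, ht⟩⟩

lemma SeparatesOddSets.exists_isPerfectMatching_of_bijOn (h : SeparatesOddSets G T 𝒞)
    (hG : IsRGraph G r) (htight : #T ≤ #𝒞) {M : G.Subgraph} (hM : M.IsPerfectMatching)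
    {c : V → Finset V} (hc : Set.BijOn c T 𝒞) {p : V → V} (hpc : ∀ t ∈ T, p t ∈ c t)
    (hp : ∀ t ∈ T, G.Adj t (p t)) :
    ∃ M' : G.Subgraph, M'.IsPerfectMatching ∧ ∀ t ∈ T, M'.Adj t (p t) := by
  obtain ⟨N, hN, hverts, hadj⟩ := h.exists_isMatching_of_bijOn hG htight hc hpc hp
  set X : Set V := ↑(T ∪ 𝒞.biUnion id)
  have hclosed : ∀ a ∈ Xᶜ, ∀ b, M.Adj a b → b ∈ Xᶜ := by
    intro a ha b hab hb
    rcases mem_union.mp hb with hbT | hb𝒞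
    · obtain ⟨C, hC, haC⟩ := h.exists_mem_of_adj hG htight hbT hab.adj_sub.symm
      exact ha (mem_union_right _ (mem_biUnion.mpr ⟨C, hC, haC⟩))
    · obtain ⟨C, hC, hbC⟩ := mem_biUnion.mp hb𝒞
      exact ha (mem_union.mpr ((h.mem_or_mem C hC b hbC a hab.adj_sub.symm).symm.imp_right
        fun haC ↦ mem_biUnion.mpr ⟨C, hC, haC⟩))
  have hrest := isMatching_induce hM.1 (fun a _ ↦ hM.2 a) hclosed
  refine ⟨N ⊔ M.induce Xᶜ, ⟨hN.sup hrest ?_, ?_⟩, fun t ht ↦ .inl (hadj t ht)⟩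
  · rw [hN.support_eq_verts, hrest.support_eq_verts, hverts]
    exact disjoint_compl_right
  · rw [Subgraph.isSpanning_iff, Subgraph.verts_sup, hverts]
    exact Set.union_compl_self X

lemma SeparatesOddSets.exists_adj_not_adj (h : SeparatesOddSets G T 𝒞) (hG : IsRGraph G r)
    (hr : 3 ≤ r) (htight : #T ≤ #𝒞) {M : G.Subgraph} (hM : M.IsPerfectMatching)
    {c : V → Finset V} (hc : Set.BijOn c T 𝒞) {v x : V} (hcx : c x = {v}) {t : V} (ht : t ∈ T) :
    ∃ s ∈ T.erase x, ∃ a ∈ c s, G.Adj t a ∧ ¬ M.Adj t a := by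
  obtain ⟨w, -, hw⟩ := Subgraph.isPerfectMatching_iff.mp hM t
  obtain ⟨a, ha, hta⟩ := exists_adj_notMem_of_card_lt_degree
    (card_le_two.trans_lt (hG.regular.degree_eq t ▸ hr) : #{v, w} < G.degree t)
  rw [mem_insert, mem_singleton, not_or] at ha
  obtain ⟨C, hC, haC⟩ := h.exists_mem_of_adj hG htight ht hta
  obtain ⟨s, hs, rfl⟩ := hc.surjOn hC
  refine ⟨s, mem_erase.mpr ⟨?_, hs⟩, a, haC, hta, fun hMta ↦ ha.2 (hw a hMta)⟩
  rintro rfl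
  exact ha.1 (mem_singleton.mp (hcx ▸ haC))

/-- The perfect matching pairs `T` with `𝒞`, each `t` going to the set containing its partner.
Redirecting every `t` other than `x` along an edge outside the matching gives a self-map of
`T \ {x}`; permuting the pairing along a cycle of this map leads to another perfect matching. -/
lemma SeparatesOddSets.exists_isPerfectMatching_ne (h : SeparatesOddSets G T 𝒞)
    (hG : IsRGraph G r) (hr : 3 ≤ r) (htight : #T ≤ #𝒞) {v x : V} (hv : {v} ∈ 𝒞)
    {M : G.Subgraph} (hM : M.IsPerfectMatching) (hvx : M.Adj v x) :
    ∃ M' : G.Subgraph, M'.IsPerfectMatching ∧ M'.Adj v x ∧ M' ≠ M := by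
  obtain ⟨c, hc, hcmem⟩ := h.exists_bijOn_of_isPerfectMatching hG htight hM
  choose p hp hp_unique using Subgraph.isPerfectMatching_iff.mp hM
  have hxT : x ∈ T := h.mem_of_adj_of_singleton_mem hv hvx.adj_sub
  have hcx : c x = {v} := h.pairwiseDisjoint.elim_finset (hc.mapsTo hxT) hv v
    (hcmem x hxT v hvx.symm) (mem_singleton_self v)
  choose! φ hφT n hnφ hn hnM using
    fun t (ht : t ∈ T.erase x) ↦ h.exists_adj_not_adj hG hr htight hM hc hcx (mem_of_mem_erase ht)
  have hT : (T.erase x).Nonempty := by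
    obtain ⟨y, hy, hvy⟩ := exists_adj_notMem_of_card_lt_degree (G := G) (v := v) (S := {x})
      (by rw [hG.regular.degree_eq, card_singleton]; omega)
    exact ⟨y, mem_erase.mpr ⟨notMem_singleton.mp hy, h.mem_of_adj_of_singleton_mem hv hvy⟩⟩
  obtain ⟨P, hPT, ⟨t₀, ht₀⟩, hφP⟩ := exists_nonempty_subset_bijOn_self hT hφT
  obtain ⟨M', hM', hadj⟩ := h.exists_isPerfectMatching_of_bijOn hG htight hM
    (hc.comp (bijOn_piecewise_id (hPT.trans (erase_subset x T)) hφP)) (p := P.piecewise n p)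
    (fun t ht ↦ by
      by_cases htP : t ∈ P
      · simpa [htP] using hnφ t (hPT htP)
      · simpa [htP] using hcmem t ht _ (hp t))
    (fun t _ ↦ by
      by_cases htP : t ∈ P
      · simpa [htP] using hn t (hPT htP)
      · simpa [htP] using (hp t).adj_sub)
  refine ⟨M', hM', ?_, ?_⟩
  · have hxP : x ∉ P := fun hx ↦ notMem_erase x T (hPT hx)
    have hxv := hadj x hxT
    rw [piecewise_eq_of_notMem _ _ _ hxP, ← hp_unique x v hvx.symm] at hxv
    exact hxv.symm
  · rintro rfl
    have hnew := hadj t₀ (mem_of_mem_erase (hPT ht₀))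
    rw [piecewise_eq_of_mem _ _ _ ht₀] at hnew
    exact hnM t₀ (hPT ht₀) hnew

end GluingMatchings

section Joins

variable {V : Type*} {G : SimpleGraph V}

lemma SeparatesOddSets.insert_singleton [DecidableEq V] {T : Finset V} {𝒞 : Finset (Finset V)}
    (h : SeparatesOddSets G T 𝒞) {v : V} (hv : v ∈ T) (hN : ∀ x, G.Adj v x → x ∈ T) :
    SeparatesOddSets G (T.erase v) (insert {v} 𝒞) where
  odd_card := forall_mem_insert _ _ _ |>.mpr ⟨by simp, h.odd_card⟩
  disjoint := forall_mem_insert _ _ _ |>.mpr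
    ⟨by simp, fun C hC ↦ (h.disjoint C hC).mono_right (erase_subset v T)⟩
  mem_or_mem := by
    refine forall_mem_insert _ _ _ |>.mpr ⟨?_, fun C hC a ha b hab ↦ ?_⟩
    · simp only [mem_singleton, forall_eq, mem_erase]
      exact fun b hvb ↦ .inr ⟨hvb.ne', hN b hvb⟩
    · refine (h.mem_or_mem C hC a ha b hab).imp_right fun hb ↦ mem_erase.mpr ⟨?_, hb⟩
      rintro rfl
      exact Finset.disjoint_left.mp (h.disjoint C hC) ha (hN a hab.symm)
  pairwiseDisjoint := by
    rw [coe_insert]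
    exact h.pairwiseDisjoint.insert fun C hC _ ↦
      disjoint_singleton_left.mpr fun hvC ↦ Finset.disjoint_left.mp (h.disjoint C hC) hvC hv

lemma exists_isJoin_of_isMatching {M : G.Subgraph} (hM : M.IsMatching) {v : V}
    (hv : (G.neighborSet v).ncard = 3) (hverts : M.verts = (insert v (G.neighborSet v))ᶜ) :
    ∃ J, IsJoin G v J := by
  have notMem {a b : V} (hab : M.Adj a b) : a ≠ v ∧ ¬ G.Adj v a := by
    have := M.edge_vert hab
    simpa [hverts, not_or] using this
  let J : G.Subgraph :=
    { verts := Set.univ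
      Adj := fun a b ↦ M.Adj a b ∨ G.Adj a b ∧ (a = v ∨ b = v)
      adj_sub := fun h ↦ h.elim (·.adj_sub) (·.1)
      edge_vert := fun _ ↦ Set.mem_univ _
      symm := ⟨fun a b h ↦ h.imp (·.symm) fun h ↦ ⟨h.1.symm, h.2.symm⟩⟩ }
  refine ⟨J, fun a ↦ Set.mem_univ a, ?_, fun w hw ↦ ?_⟩
  · convert hv using 2
    ext a
    exact ⟨fun h ↦ h.elim (fun h ↦ absurd rfl (notMem h).1) (·.1), fun h ↦ .inr ⟨h, .inl rfl⟩⟩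
  · rw [Set.ncard_eq_one]
    by_cases hvw : G.Adj v w
    · refine ⟨v, Set.ext fun a ↦ ⟨?_, ?_⟩⟩
      · exact fun h ↦ h.elim (fun h ↦ absurd hvw (notMem h).2) fun h ↦ h.2.resolve_left hw
      · rintro rfl
        exact .inr ⟨hvw.symm, .inr rfl⟩
    · obtain ⟨b, hwb, hb⟩ := hM (by simp [hverts, hw, hvw] : w ∈ M.verts)
      refine ⟨b, Set.ext fun a ↦ ⟨?_, ?_⟩⟩
      · rintro (h | ⟨h, rfl | rfl⟩)
        exacts [hb a h, absurd rfl hw, absurd h.symm hvw]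
      · rintro rfl
        exact .inl hwb

lemma IsRGraph.exists_separatesOddSets_of_forall_not_isJoin [Fintype V] [DecidableEq V]
    [DecidableRel G.Adj] (hG : IsRGraph G 3) {v : V} (hv : ∀ J, ¬ IsJoin G v J) :
    ∃ T 𝒞, SeparatesOddSets G T 𝒞 ∧ {v} ∈ 𝒞 ∧ #T ≤ #𝒞 := by
  have hcard : #(insert v (G.neighborFinset v)) = 4 := by
    rw [card_insert_of_notMem (G.notMem_neighborFinset_self v), card_neighborFinset_eq_degree,
      hG.regular.degree_eq]
  obtain ⟨T, 𝒞, hT, h, hT𝒞⟩ := exists_separatesOddSets_of_forall_not_isMatching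
    (G := G) (insert v (G.neighborFinset v))
    (by
      rw [card_compl, hcard, Nat.even_sub (hcard ▸ card_le_univ _)]
      exact iff_of_true (hG.even_card three_pos) (by decide))
    (fun M hM hverts ↦ by
      obtain ⟨J, hJ⟩ := exists_isJoin_of_isMatching hM (hG.ncard_neighborSet v)
        (by rw [hverts, coe_compl, coe_insert, coe_neighborFinset])
      exact hv J hJ)
  have hvT : v ∈ T := hT (mem_insert_self _ _)
  have hv𝒞 : {v} ∉ 𝒞 := fun hv𝒞 ↦ disjoint_singleton_left.mp (h.disjoint _ hv𝒞) hvT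
  refine ⟨T.erase v, insert {v} 𝒞, h.insert_singleton hvT fun x hvx ↦ hT ?_,
    mem_insert_self _ _, ?_⟩
  · simpa using Or.inr hvx
  · rw [card_erase_of_mem hvT, card_insert_of_notMem hv𝒞]
    omega

lemma IsThreeConnected.not_isBridge [Fintype V] (hG : IsThreeConnected G) {e : Sym2 V}
    (he : e ∈ G.edgeSet) : ¬ G.IsBridge e := by
  classical
  induction e with | _ a b
  rw [mem_edgeSet] at he
  obtain ⟨c, -, hc⟩ : ∃ c ∈ (univ : Finset V), c ∉ ({a, b} : Finset V) :=
    exists_mem_notMem_of_card_lt_card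
      (by have := hG.1; have := card_le_two (a := a) (b := b); rw [card_univ]; omega)
  rw [mem_insert, mem_singleton, not_or] at hc
  have reachable {u w : V} (hu : u ∈ s(a, b)) (hw : w ≠ u) (hcu : c ≠ u) :
      (G.deleteEdges {s(a, b)}).Reachable c w := by
    have hconn := hG.2 {u} (by simp)
    let f : G.induce ((({u} : Finset V) : Set V)ᶜ) →g G.deleteEdges {s(a, b)} :=
      { toFun := Subtype.val
        map_rel' := fun {x y} hxy ↦ deleteEdges_adj.mpr ⟨hxy, fun hmem ↦ by
          have := Set.mem_singleton_iff.mp hmem ▸ hu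
          rcases Sym2.mem_iff.mp this with hux | huy
          exacts [x.2 (by simp [hux]), y.2 (by simp [huy])]⟩ }
    exact (hconn.preconnected ⟨c, by simpa⟩ ⟨w, by simpa⟩).map f
  rw [isBridge_iff, not_not]
  exact (reachable (Sym2.mem_mk_right a b) he.ne hc.2).symm.trans
    (reachable (Sym2.mem_mk_left a b) he.ne' hc.1)

end Joins

lemma exists_compl_pair_eq_singleton {α : Type*} (hα : Nat.card α = 3) {x y : α} (hxy : x ≠ y) :
    ∃ z, ({x, y}ᶜ : Set α) = {z} := by
  have : Finite α := Nat.finite_of_card_ne_zero (hα ▸ three_ne_zero)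
  have hsum := Set.ncard_add_ncard_compl {x, y}
  rw [Set.ncard_pair hxy, hα] at hsum
  exact Set.ncard_eq_one.mp (by omega)

lemma exists_ne_compl_pair_eq_singleton {α : Type*} (hα : Nat.card α = 3) (x : α) :
    ∃ y z, y ≠ z ∧ ({y, z}ᶜ : Set α) = {x} := by
  have : Finite α := Nat.finite_of_card_ne_zero (hα ▸ three_ne_zero)
  have hsum := Set.ncard_add_ncard_compl {x}
  rw [Set.ncard_singleton, hα] at hsum
  obtain ⟨y, z, hyz, hx⟩ := Set.ncard_eq_two.mp (show ({x}ᶜ : Set α).ncard = 2 by omega)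
  exact ⟨y, z, hyz, by rw [← hx, compl_compl]⟩

section Expansion

variable {V : Type*} {G : SimpleGraph V} {v : V}

/-- The map `G^v → G` contracting the triangle onto `v`. -/
def contractVertex : ExpandVertex G v → V :=
  Sum.elim Subtype.val fun _ ↦ v

lemma eq_of_adj_of_contractVertex_eq {u w u' w' : ExpandVertex G v} (huw : (expand G v).Adj u w)
    (huw' : (expand G v).Adj u' w') (hne : contractVertex u ≠ contractVertex w)
    (hu : contractVertex u = contractVertex u') (hw : contractVertex w = contractVertex w') :
    u = u' := by
  rcases u with a | x <;> rcases u' with a' | x'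
  · exact congrArg Sum.inl (Subtype.ext hu)
  · exact absurd hu a.2
  · exact absurd hu.symm a'.2
  · rcases w with b | y <;> rcases w' with b' | y'
    · exact congrArg Sum.inr (Subtype.ext (Eq.trans (Eq.symm huw) (Eq.trans hw huw')))
    · exact absurd hw b.2
    all_goals exact absurd rfl hne

lemma adj_contractVertex {u w : ExpandVertex G v} (huw : (expand G v).Adj u w)
    (hne : contractVertex u ≠ contractVertex w) :
    G.Adj (contractVertex u) (contractVertex w) := by
  rcases u with a | x <;> rcases w with b | y
  · exact huw
  · exact Eq.subst (motive := (G.Adj · v)) (Eq.symm huw) y.2.symm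
  · exact Eq.subst (motive := G.Adj v) (Eq.symm huw) x.2
  · exact absurd rfl hne

/-- The subgraph of `G^v` induced by a spanning subgraph `J` of `G`: the edges of `J`, together with
the triangle edges joining two new vertices which no edge of `J` reaches. For perfect matchings and
`v`-joins `J` of a cubic graph it is a perfect matching. -/
def liftSubgraph (v : V) (J : G.Subgraph) : (expand G v).Subgraph where
  verts := Set.univ
  Adj u w := (expand G v).Adj u w ∧
    (contractVertex u ≠ contractVertex w → J.Adj (contractVertex u) (contractVertex w)) ∧
    ∀ x y, u = .inr x → w = .inr y → ¬ J.Adj v x ∧ ¬ J.Adj v y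
  adj_sub := fun h ↦ h.1
  edge_vert := fun _ ↦ Set.mem_univ _
  symm := ⟨fun _ _ h ↦
    ⟨h.1.symm, fun hne ↦ (h.2.1 hne.symm).symm, fun x y hx hy ↦ (h.2.2 y x hy hx).symm⟩⟩

/-- The spanning subgraph of `G` obtained from a subgraph of `G^v` by contracting the triangle
to `v`. -/
def contractSubgraph (M : (expand G v).Subgraph) : G.Subgraph where
  verts := Set.univ
  Adj a b := a ≠ b ∧ ∃ u w, M.Adj u w ∧ contractVertex u = a ∧ contractVertex w = b
  adj_sub := by
    rintro _ _ ⟨hne, u, w, huw, rfl, rfl⟩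
    exact adj_contractVertex huw.adj_sub hne
  edge_vert := fun _ ↦ Set.mem_univ _
  symm := ⟨fun a b ⟨hne, u, w, huw, hu, hw⟩ ↦ ⟨hne.symm, w, u, huw.symm, hw, hu⟩⟩

variable {J : G.Subgraph}

lemma liftSubgraph_adj_iff_of_contractVertex_ne {u w : ExpandVertex G v}
    (huw : (expand G v).Adj u w) (hne : contractVertex u ≠ contractVertex w) :
    (liftSubgraph v J).Adj u w ↔ J.Adj (contractVertex u) (contractVertex w) := by
  refine ⟨fun h ↦ h.2.1 hne, fun h ↦ ⟨huw, fun _ ↦ h, ?_⟩⟩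
  rintro x y rfl rfl
  exact absurd rfl hne

lemma liftSubgraph_adj_inr_inr {x y : G.neighborSet v} :
    (liftSubgraph v J).Adj (.inr x) (.inr y) ↔ x ≠ y ∧ ¬ J.Adj v x ∧ ¬ J.Adj v y :=
  ⟨fun h ↦ ⟨h.1, h.2.2 x y rfl rfl⟩, fun h ↦ ⟨h.1, fun hne ↦ absurd rfl hne, by
    rintro _ _ ⟨⟩ ⟨⟩
    exact h.2⟩⟩

lemma liftSubgraph_adj_inl_inl {a b : {w : V // w ≠ v}} :
    (liftSubgraph v J).Adj (.inl a) (.inl b) ↔ J.Adj a b :=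
  ⟨fun h ↦ h.2.1 (G.ne_of_adj h.1), fun h ↦ ⟨h.adj_sub, fun _ ↦ h, nofun⟩⟩

lemma liftSubgraph_adj_inl_inr {a : {w : V // w ≠ v}} {x : G.neighborSet v} :
    (liftSubgraph v J).Adj (.inl a) (.inr x) ↔ (a : V) = x ∧ J.Adj a v :=
  ⟨fun h ↦ ⟨h.1, h.2.1 a.2⟩, fun h ↦ ⟨h.1, fun _ ↦ h.2, nofun⟩⟩

lemma injOn_liftSubgraph : Set.InjOn (liftSubgraph v) {J : G.Subgraph | J.IsSpanning} := by
  intro J hJ J' hJ' heq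
  have adj_iff {a b : V} (hab : G.Adj a b) (ha : a ≠ v) : J.Adj a b ↔ J'.Adj a b := by
    by_cases hb : b = v
    · subst hb
      have := @liftSubgraph_adj_inl_inr _ _ b J ⟨a, ha⟩ ⟨a, hab.symm⟩
      rw [heq, liftSubgraph_adj_inl_inr] at this
      simpa using this.symm
    · rw [← liftSubgraph_adj_inl_inl (a := ⟨a, ha⟩) (b := ⟨b, hb⟩), heq, liftSubgraph_adj_inl_inl]
  refine Subgraph.ext (hJ.verts_eq_univ.trans hJ'.verts_eq_univ.symm) ?_
  ext a b
  by_cases hab : G.Adj a b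
  · by_cases ha : a = v
    · rw [J.adj_comm, J'.adj_comm]
      exact adj_iff hab.symm (ha ▸ hab.ne')
    · exact adj_iff hab ha
  · exact iff_of_false (fun h ↦ hab h.adj_sub) (fun h ↦ hab h.adj_sub)

lemma ncard_neighborSet_liftSubgraph_inl (a : {w : V // w ≠ v}) :
    ((liftSubgraph v J).neighborSet (.inl a)).ncard = (J.neighborSet a).ncard := by
  have hinj : Set.InjOn contractVertex ((liftSubgraph v J).neighborSet (.inl a)) := by
    have ne_of_adj {w} (hw : (liftSubgraph v J).Adj (.inl a) w) :
        contractVertex (.inl a : ExpandVertex G v) ≠ contractVertex w := by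
      rcases w with b | x
      exacts [(liftSubgraph_adj_inl_inl.mp hw).ne, a.2]
    intro w hw w' hw' heq
    rw [Subgraph.mem_neighborSet] at hw hw'
    exact eq_of_adj_of_contractVertex_eq hw.adj_sub.symm hw'.adj_sub.symm (ne_of_adj hw).symm
      heq rfl
  rw [← hinj.ncard_image]
  congr
  ext b
  constructor
  · rintro ⟨b | x, h, rfl⟩
    exacts [liftSubgraph_adj_inl_inl.mp h, (liftSubgraph_adj_inl_inr.mp h).2]
  · intro hab
    by_cases hb : b = v
    · subst hb
      exact ⟨.inr ⟨a, hab.adj_sub.symm⟩, liftSubgraph_adj_inl_inr.mpr ⟨rfl, hab⟩, rfl⟩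
    · exact ⟨.inl ⟨b, hb⟩, liftSubgraph_adj_inl_inl.mpr hab, rfl⟩

lemma neighborSet_liftSubgraph_inr_of_adj {x : G.neighborSet v} (hx : J.Adj v x) :
    (liftSubgraph v J).neighborSet (.inr x) = {.inl ⟨x, x.2.ne'⟩} := by
  ext (a | y)
  · rw [Subgraph.mem_neighborSet, Subgraph.adj_comm, liftSubgraph_adj_inl_inr,
      Set.mem_singleton_iff, Sum.inl.injEq, Subtype.ext_iff]
    exact and_iff_left_of_imp fun h ↦ h ▸ hx.symm
  · simp [liftSubgraph_adj_inr_inr, hx]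

lemma neighborSet_liftSubgraph_inr_of_not_adj {x : G.neighborSet v} (hx : ¬ J.Adj v x) :
    (liftSubgraph v J).neighborSet (.inr x) =
      Sum.inr '' ({y : G.neighborSet v | ¬ J.Adj v y} \ {x}) := by
  ext (a | y)
  · rw [Subgraph.mem_neighborSet, Subgraph.adj_comm, liftSubgraph_adj_inl_inr]
    refine iff_of_false ?_ (by simp)
    rintro ⟨hax, hav⟩
    exact hx (hax ▸ hav.symm)
  · simp [liftSubgraph_adj_inr_inr, hx, eq_comm, and_comm]

lemma ncard_neighborSet_add_ncard_not_adj (hv : (G.neighborSet v).ncard = 3) :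
    (J.neighborSet v).ncard + {y : G.neighborSet v | ¬ J.Adj v y}.ncard = 3 := by
  have : Finite (G.neighborSet v) := Set.finite_of_ncard_pos (hv ▸ three_pos)
  have himage : J.neighborSet v = Subtype.val '' {y : G.neighborSet v | J.Adj v y} := by
    ext a
    exact ⟨fun h ↦ ⟨⟨a, h.adj_sub⟩, h, rfl⟩, by rintro ⟨y, hy, rfl⟩; exact hy⟩
  rw [himage, Set.ncard_image_of_injective _ Subtype.val_injective, ← hv,
    ← Nat.card_coe_set_eq (G.neighborSet v),
    ← Set.ncard_add_ncard_compl {y : G.neighborSet v | J.Adj v y}]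
  rfl

lemma forall_ncard_neighborSet_liftSubgraph_inr_iff (hv : (G.neighborSet v).ncard = 3) :
    (∀ x, ((liftSubgraph v J).neighborSet (.inr x)).ncard = 1) ↔
      (J.neighborSet v).ncard = 1 ∨ (J.neighborSet v).ncard = 3 := by
  have : Finite (G.neighborSet v) := Set.finite_of_ncard_pos (hv ▸ three_pos)
  have hsum := ncard_neighborSet_add_ncard_not_adj (J := J) hv
  set N := {y : G.neighborSet v | ¬ J.Adj v y}
  have ncard_of_mem {x} (hx : x ∈ N) :
      ((liftSubgraph v J).neighborSet (.inr x)).ncard + 1 = N.ncard := by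
    rw [neighborSet_liftSubgraph_inr_of_not_adj hx,
      Set.ncard_image_of_injective _ Sum.inr_injective, Set.ncard_sdiff_singleton_add_one hx]
  constructor
  · intro h
    rcases N.eq_empty_or_nonempty with hN | ⟨x, hx⟩
    · rw [hN, Set.ncard_empty] at hsum
      exact .inr hsum
    · have := ncard_of_mem hx
      rw [h x] at this
      omega
  · intro h x
    by_cases hx : J.Adj v x
    · rw [neighborSet_liftSubgraph_inr_of_adj hx, Set.ncard_singleton]
    · have := ncard_of_mem hx
      have : 0 < N.ncard := (Set.ncard_pos N.toFinite).mpr ⟨x, hx⟩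
      omega

lemma isPerfectMatching_iff_ncard_neighborSet {W : Type*} {H : SimpleGraph W} {M : H.Subgraph} :
    M.IsPerfectMatching ↔ ∀ w, (M.neighborSet w).ncard = 1 := by
  simp only [Subgraph.isPerfectMatching_iff, Set.ncard_eq_one, Set.eq_singleton_iff_unique_mem]
  rfl

lemma isPerfectMatching_liftSubgraph_iff (hv : (G.neighborSet v).ncard = 3) (hJ : J.IsSpanning) :
    (liftSubgraph v J).IsPerfectMatching ↔ J.IsPerfectMatching ∨ IsJoin G v J := by
  rw [isPerfectMatching_iff_ncard_neighborSet, isPerfectMatching_iff_ncard_neighborSet, IsJoin,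
    Sum.forall, forall_ncard_neighborSet_liftSubgraph_inr_iff hv]
  simp only [ncard_neighborSet_liftSubgraph_inl, Subtype.forall]
  constructor
  · rintro ⟨hoff, hone | hthree⟩
    · exact .inl fun w ↦ (eq_or_ne w v).elim (· ▸ hone) (hoff w)
    · exact .inr ⟨hJ, hthree, hoff⟩
  · rintro (h | ⟨-, hthree, hoff⟩)
    exacts [⟨fun w _ ↦ h w, .inl (h v)⟩, ⟨hoff, .inr hthree⟩]

lemma contractSubgraph_adj_contractVertex {M : (expand G v).Subgraph} {u w : ExpandVertex G v}
    (huw : (expand G v).Adj u w) (hne : contractVertex u ≠ contractVertex w) :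
    (contractSubgraph M).Adj (contractVertex u) (contractVertex w) ↔ M.Adj u w := by
  refine ⟨fun ⟨_, u', w', h, hu, hw⟩ ↦ ?_, fun h ↦ ⟨hne, u, w, h, rfl, rfl⟩⟩
  rwa [eq_of_adj_of_contractVertex_eq huw h.adj_sub hne hu.symm hw.symm,
    eq_of_adj_of_contractVertex_eq huw.symm h.adj_sub.symm hne.symm hw.symm hu.symm]

lemma contractSubgraph_adj_vertex {M : (expand G v).Subgraph} {x : G.neighborSet v} :
    (contractSubgraph M).Adj v x ↔ M.Adj (.inl ⟨x, x.2.ne'⟩) (.inr x) := by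
  rw [Subgraph.adj_comm]
  exact contractSubgraph_adj_contractVertex (G := G) (v := v) (u := .inl ⟨x, x.2.ne'⟩)
    (w := .inr x) rfl x.2.ne'

lemma adj_inr_inr_iff_of_isPerfectMatching (hv : (G.neighborSet v).ncard = 3)
    {M : (expand G v).Subgraph} (hM : M.IsPerfectMatching) {x y : G.neighborSet v} (hxy : x ≠ y) :
    M.Adj (.inr x) (.inr y) ↔
      ¬ M.Adj (.inl ⟨x, x.2.ne'⟩) (.inr x) ∧ ¬ M.Adj (.inl ⟨y, y.2.ne'⟩) (.inr y) := by
  have existsUnique_adj := Subgraph.isPerfectMatching_iff.mp hM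
  have adj_outer_or {x : G.neighborSet v} :
      M.Adj (.inl ⟨x, x.2.ne'⟩) (.inr x) ∨ ∃ y ≠ x, M.Adj (.inr x) (.inr y) := by
    obtain ⟨a | y, h, -⟩ := existsUnique_adj (.inr x)
    · obtain rfl : a = ⟨x, x.2.ne'⟩ := Subtype.ext h.adj_sub
      exact .inl h.symm
    · exact .inr ⟨y, h.ne.symm ∘ congrArg Sum.inr, h⟩
  have not_adj_outer {x y : G.neighborSet v} (h : M.Adj (.inr x) (.inr y)) :
      ¬ M.Adj (.inl ⟨x, x.2.ne'⟩) (.inr x) :=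
    fun h' ↦ Sum.inr_ne_inl ((existsUnique_adj _).unique h h'.symm)
  refine ⟨fun h ↦ ⟨not_adj_outer h, not_adj_outer h.symm⟩, fun ⟨hx, hy⟩ ↦ ?_⟩
  obtain ⟨x', hx', hxx'⟩ := adj_outer_or.resolve_left hx
  obtain ⟨y', hy', hyy'⟩ := adj_outer_or.resolve_left hy
  by_contra hnot
  have hx'y : x' ≠ y := by rintro rfl; exact hnot hxx'
  have hy'x : y' ≠ x := by rintro rfl; exact hnot hyy'.symm
  have hx'y' : x' = y' := by
    obtain ⟨z, hz⟩ := exists_compl_pair_eq_singleton hv hxy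
    have eq_third {w : G.neighborSet v} (hwx : w ≠ x) (hwy : w ≠ y) : w = z :=
      hz.subset (by simp [hwx, hwy])
    exact (eq_third hx' hx'y).trans (eq_third hy'x hy').symm
  exact hxy (Sum.inr_injective ((existsUnique_adj _).unique hxx'.symm (hx'y' ▸ hyy'.symm)))

lemma liftSubgraph_contractSubgraph (hv : (G.neighborSet v).ncard = 3)
    {M : (expand G v).Subgraph} (hM : M.IsPerfectMatching) :
    liftSubgraph v (contractSubgraph M) = M := by
  refine Subgraph.ext hM.2.verts_eq_univ.symm ?_
  ext u w
  by_cases huw : (expand G v).Adj u w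
  · by_cases hne : contractVertex u = contractVertex w
    · rcases u with a | x <;> rcases w with b | y
      · exact absurd hne (G.ne_of_adj huw)
      · exact absurd hne a.2
      · exact absurd hne.symm b.2
      · have hxy : x ≠ y := huw
        rw [liftSubgraph_adj_inr_inr, contractSubgraph_adj_vertex, contractSubgraph_adj_vertex,
          adj_inr_inr_iff_of_isPerfectMatching hv hM hxy, and_iff_right hxy]
    · rw [liftSubgraph_adj_iff_of_contractVertex_ne huw hne,
        contractSubgraph_adj_contractVertex huw hne]
  · exact iff_of_false (fun h ↦ huw h.adj_sub) (fun h ↦ huw h.adj_sub)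

lemma bijOn_liftSubgraph (hv : (G.neighborSet v).ncard = 3) :
    Set.BijOn (liftSubgraph v) {J : G.Subgraph | J.IsPerfectMatching ∨ IsJoin G v J}
      {M | M.IsPerfectMatching} := by
  have isSpanning {J : G.Subgraph} (hJ : J.IsPerfectMatching ∨ IsJoin G v J) : J.IsSpanning :=
    hJ.elim (·.2) (·.1)
  refine ⟨fun J hJ ↦ (isPerfectMatching_liftSubgraph_iff hv (isSpanning hJ)).mpr hJ,
    injOn_liftSubgraph.mono fun J ↦ isSpanning, fun M hM ↦ ?_⟩
  have hlift := liftSubgraph_contractSubgraph hv hM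
  refine ⟨contractSubgraph M, ?_, hlift⟩
  rwa [Set.mem_ofPred_eq, ← isPerfectMatching_liftSubgraph_iff hv fun _ ↦ Set.mem_univ _, hlift]

end Expansion

section LonelyEdge

variable {V : Type*} {G : SimpleGraph V} {v : V}

/-- The perfect matchings of `G` containing the edge `e`. -/
def perfectMatchingsThrough (G : SimpleGraph V) (e : Sym2 V) : Set G.Subgraph :=
  {M | M.IsPerfectMatching ∧ e ∈ M.edgeSet}

/-- The `v`-joins of `G` containing the edge `e`. -/
def joinsThrough (G : SimpleGraph V) (v : V) (e : Sym2 V) : Set G.Subgraph :=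
  {J | IsJoin G v J ∧ e ∈ J.edgeSet}

lemma isLonely_iff_ncard_perfectMatchingsThrough {e : Sym2 V} :
    IsLonely G e ↔ (perfectMatchingsThrough G e).ncard = 1 := by
  rw [Set.ncard_eq_one, IsLonely]
  constructor
  · rintro ⟨-, M, hM, hM_unique⟩
    exact ⟨M, Set.eq_singleton_iff_unique_mem.mpr ⟨hM, hM_unique⟩⟩
  · rintro ⟨M, hM⟩
    obtain ⟨hmem, hM_unique⟩ := Set.eq_singleton_iff_unique_mem.mp hM
    exact ⟨M.edgeSet_subset hmem.2, M, hmem, hM_unique⟩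

lemma not_isJoin_of_isPerfectMatching {M : G.Subgraph} (hM : M.IsPerfectMatching) :
    ¬ IsJoin G v M := fun hJ ↦ by
  have := hJ.2.1
  rw [isPerfectMatching_iff_ncard_neighborSet.mp hM v] at this
  omega

lemma disjoint_perfectMatchingsThrough_joinsThrough {e : Sym2 V} :
    Disjoint (perfectMatchingsThrough G e) (joinsThrough G v e) :=
  Set.disjoint_left.mpr fun _ hM hJ ↦ not_isJoin_of_isPerfectMatching hM.1 hJ.1

lemma IsJoin.adj_of_adj (hv : (G.neighborSet v).ncard = 3) {J : G.Subgraph} (hJ : IsJoin G v J)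
    {x : V} (hvx : G.Adj v x) : J.Adj v x := by
  have heq := Set.eq_of_subset_of_ncard_le (J.neighborSet_subset v) (by rw [hv, hJ.2.1])
    (Set.finite_of_ncard_pos (hv ▸ three_pos))
  exact heq.symm.subset hvx

lemma perfectMatchingsThrough_expand_mk (hv : (G.neighborSet v).ncard = 3) {u w : ExpandVertex G v}
    (huw : (expand G v).Adj u w) (hne : contractVertex u ≠ contractVertex w) :
    perfectMatchingsThrough (expand G v) s(u, w) = liftSubgraph v ''
      (perfectMatchingsThrough G s(contractVertex u, contractVertex w) ∪
        joinsThrough G v s(contractVertex u, contractVertex w)) := by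
  ext M
  constructor
  · rintro ⟨hM, hmem⟩
    obtain ⟨J, hJ, rfl⟩ := (bijOn_liftSubgraph hv).surjOn hM
    have hadj := (liftSubgraph_adj_iff_of_contractVertex_ne huw hne).mp hmem
    exact ⟨J, hJ.imp (⟨·, hadj⟩) (⟨·, hadj⟩), rfl⟩
  · rintro ⟨J, hJ, rfl⟩
    exact ⟨(bijOn_liftSubgraph hv).mapsTo (hJ.imp (·.1) (·.1)),
      (liftSubgraph_adj_iff_of_contractVertex_ne huw hne).mpr (hJ.elim (·.2) (·.2))⟩

lemma perfectMatchingsThrough_expand_inr_inr (hv : (G.neighborSet v).ncard = 3)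
    {x y z : G.neighborSet v} (hyz : y ≠ z) (hx : ({y, z}ᶜ : Set (G.neighborSet v)) = {x}) :
    perfectMatchingsThrough (expand G v) s(.inr y, .inr z) =
      liftSubgraph v '' perfectMatchingsThrough G s(v, x) := by
  have hxyz : x ∉ ({y, z} : Set (G.neighborSet v)) := hx.symm.subset rfl
  rw [Set.mem_insert_iff, Set.mem_singleton_iff, not_or] at hxyz
  ext M
  constructor
  · rintro ⟨hM, hmem⟩
    obtain ⟨J, hJ, rfl⟩ := (bijOn_liftSubgraph hv).surjOn hM
    obtain ⟨-, hy, hz⟩ := liftSubgraph_adj_inr_inr.mp hmem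
    have hJ' := hJ.resolve_right fun hJ ↦ hy (hJ.adj_of_adj hv y.2)
    obtain ⟨w, hvw, -⟩ := Subgraph.isPerfectMatching_iff.mp hJ' v
    obtain rfl : ⟨w, hvw.adj_sub⟩ = x := by
      refine hx.subset ?_
      rintro (rfl | rfl)
      exacts [hy hvw, hz hvw]
    exact ⟨J, ⟨hJ', hvw⟩, rfl⟩
  · rintro ⟨J, ⟨hJ, hvx⟩, rfl⟩
    have not_adj {w : G.neighborSet v} (hxw : x ≠ w) : ¬ J.Adj v w := fun hvw ↦
      hxw (Subtype.ext ((Subgraph.isPerfectMatching_iff.mp hJ v).unique hvx hvw))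
    exact ⟨(bijOn_liftSubgraph hv).mapsTo (.inl hJ),
      liftSubgraph_adj_inr_inr.mpr ⟨hyz, not_adj hxyz.1, not_adj hxyz.2⟩⟩

lemma isLonely_expand_inr_inr_iff (hv : (G.neighborSet v).ncard = 3)
    {x y z : G.neighborSet v} (hyz : y ≠ z) (hx : ({y, z}ᶜ : Set (G.neighborSet v)) = {x}) :
    IsLonely (expand G v) s(.inr y, .inr z) ↔ IsLonely G s(v, x) := by
  rw [isLonely_iff_ncard_perfectMatchingsThrough, isLonely_iff_ncard_perfectMatchingsThrough,
    perfectMatchingsThrough_expand_inr_inr hv hyz hx,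
    (injOn_liftSubgraph.mono fun J hJ ↦ hJ.1.2).ncard_image]

lemma ncard_perfectMatchingsThrough_expand_mk [Finite V] (hv : (G.neighborSet v).ncard = 3)
    {u w : ExpandVertex G v} (huw : (expand G v).Adj u w)
    (hne : contractVertex u ≠ contractVertex w) :
    (perfectMatchingsThrough (expand G v) s(u, w)).ncard =
      (perfectMatchingsThrough G s(contractVertex u, contractVertex w)).ncard +
        (joinsThrough G v s(contractVertex u, contractVertex w)).ncard := by
  rw [perfectMatchingsThrough_expand_mk hv huw hne,
    (injOn_liftSubgraph.mono fun J hJ ↦ hJ.elim (·.1.2) (·.1.1)).ncard_image,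
    Set.ncard_union_eq disjoint_perfectMatchingsThrough_joinsThrough]

variable [Fintype V] [DecidableEq V] [DecidableRel G.Adj]

lemma IsRGraph.isLonely_expand_mk_iff (hG : IsRGraph G 3) {u w : ExpandVertex G v}
    (huw : (expand G v).Adj u w) (hne : contractVertex u ≠ contractVertex w) :
    IsLonely (expand G v) s(u, w) ↔
      IsLonely G s(contractVertex u, contractVertex w) ∧
        joinsThrough G v s(contractVertex u, contractVertex w) = ∅ := by
  have hpos : 0 < (perfectMatchingsThrough G s(contractVertex u, contractVertex w)).ncard :=
    (Set.ncard_pos).mpr (hG.exists_isPerfectMatching_adj (adj_contractVertex huw hne))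
  rw [isLonely_iff_ncard_perfectMatchingsThrough, isLonely_iff_ncard_perfectMatchingsThrough,
    ncard_perfectMatchingsThrough_expand_mk (hG.ncard_neighborSet v) huw hne, ← Set.ncard_eq_zero]
  omega

lemma IsRGraph.not_isLonely_of_forall_not_isJoin (hG : IsRGraph G 3) (hv : ∀ J, ¬ IsJoin G v J)
    {x : V} : ¬ IsLonely G s(v, x) := by
  rintro ⟨-, M, ⟨hM, hvx⟩, hM_unique⟩
  obtain ⟨T, 𝒞, h, hv𝒞, htight⟩ := hG.exists_separatesOddSets_of_forall_not_isJoin hv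
  obtain ⟨M', hM', hvx', hne⟩ := h.exists_isPerfectMatching_ne hG le_rfl htight hv𝒞 hM hvx
  exact hne (hM_unique M' ⟨hM', hvx'⟩)

lemma IsRGraph.not_isLonely_expand_inl_inr (hG : IsRGraph G 3) {a : {w : V // w ≠ v}}
    {x : G.neighborSet v} : ¬ IsLonely (expand G v) s(.inl a, .inr x) := by
  intro he
  obtain ⟨hlonely, hjoins⟩ := (hG.isLonely_expand_mk_iff ((mem_edgeSet _).mp he.1) a.2).mp he
  have hav : G.Adj v a := hlonely.1.symm
  refine hG.not_isLonely_of_forall_not_isJoin (fun J hJ ↦ ?_) (Sym2.eq_swap ▸ hlonely)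
  have hJa : s((a : V), v) ∈ J.edgeSet := (hJ.adj_of_adj (hG.ncard_neighborSet v) hav).symm
  exact hjoins.subset (⟨hJ, hJa⟩ : J ∈ joinsThrough G v s((a : V), v))

end LonelyEdge

section Counting

variable {V : Type*} {G : SimpleGraph V} {v : V}

lemma ncard_isLonely_mem :
    {e | IsLonely G e ∧ v ∈ e}.ncard = {x : G.neighborSet v | IsLonely G s(v, x)}.ncard := by
  have hinj : Function.Injective fun x : G.neighborSet v ↦ s(v, (x : V)) :=
    fun x y hxy ↦ Subtype.ext (Sym2.congr_right.mp hxy)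
  rw [← Set.ncard_image_of_injective _ hinj]
  congr
  ext e
  constructor
  · rintro ⟨he, x, rfl⟩
    exact ⟨⟨x, he.1⟩, he, rfl⟩
  · rintro ⟨x, hx, rfl⟩
    exact ⟨hx, Sym2.mem_mk_left v x⟩

lemma ncard_isLonely_expand_map_inr (hv : (G.neighborSet v).ncard = 3) :
    {e : Sym2 (G.neighborSet v) | IsLonely (expand G v) (e.map .inr)}.ncard =
      {x : G.neighborSet v | IsLonely G s(v, x)}.ncard := by
  choose y z hyz hx using exists_ne_compl_pair_eq_singleton hv
  have mk_eq_iff {p q : G.neighborSet v} {x} : s(y x, z x) = s(p, q) ↔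
      ({p, q}ᶜ : Set (G.neighborSet v)) = {x} := by
    rw [← hx x, compl_inj_iff, Set.pair_eq_pair_iff, Sym2.eq_iff]
    grind
  have hinj : Function.Injective fun x ↦ s(y x, z x) := fun x x' heq ↦
    Set.singleton_injective ((mk_eq_iff.mp heq).symm.trans (hx x'))
  rw [← Set.ncard_image_of_injective _ hinj]
  congr
  ext e
  constructor
  · induction e with | _ p q
    intro he
    have hpq : p ≠ q := he.1
    obtain ⟨x, hpqx⟩ := exists_compl_pair_eq_singleton hv hpq
    exact ⟨x, (isLonely_expand_inr_inr_iff hv hpq hpqx).mp he, mk_eq_iff.mpr hpqx⟩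
  · rintro ⟨x, hlonely, rfl⟩
    exact (isLonely_expand_inr_inr_iff hv (hyz x) (hx x)).mpr hlonely

lemma lonelyCount_eq_add [Finite V] (G : SimpleGraph V) (v : V) : lonelyCount G =
    {e | IsLonely G e ∧ v ∈ e}.ncard +
      ({e | (IsLonely G e ∧ v ∉ e) ∧ joinsThrough G v e = ∅}.ncard + joinLonelyCount G v) := by
  rw [lonelyCount, ← Set.ncard_inter_add_ncard_sdiff_eq_ncard {e | IsLonely G e} {e | v ∈ e},
    ← Set.ncard_inter_add_ncard_sdiff_eq_ncard ({e | IsLonely G e} \ {e | v ∈ e})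
      {e | joinsThrough G v e = ∅}, joinLonelyCount]
  congr 3
  ext e
  exact ⟨fun h ↦ ⟨h.1.1, h.1.2, Set.nonempty_iff_ne_empty.mpr h.2⟩,
    fun h ↦ ⟨⟨h.1, h.2.1⟩, Set.nonempty_iff_ne_empty.mp h.2.2⟩⟩

variable [Fintype V] [DecidableEq V] [DecidableRel G.Adj]

lemma IsRGraph.lonelyCount_expand (hG : IsRGraph G 3) : lonelyCount (expand G v) =
    {e : Sym2 {w : V // w ≠ v} | IsLonely (expand G v) (e.map .inl)}.ncard +
      {e : Sym2 (G.neighborSet v) | IsLonely (expand G v) (e.map .inr)}.ncard := by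
  have hinl : Function.Injective (Sym2.map (.inl : _ → ExpandVertex G v)) :=
    Sym2.map.injective Sum.inl_injective
  have hinr : Function.Injective (Sym2.map (.inr : _ → ExpandVertex G v)) :=
    Sym2.map.injective Sum.inr_injective
  rw [← Set.ncard_image_of_injective _ hinl, ← Set.ncard_image_of_injective _ hinr,
    ← Set.ncard_union_eq, lonelyCount]
  · congr
    ext e
    constructor
    · induction e with | _ u w
      intro he
      rcases u with a | x <;> rcases w with b | y
      · exact .inl ⟨s(a, b), he, rfl⟩
      · exact absurd he hG.not_isLonely_expand_inl_inr
      · exact absurd (Sym2.eq_swap ▸ he) hG.not_isLonely_expand_inl_inr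
      · exact .inr ⟨s(x, y), he, rfl⟩
    · rintro (⟨e, he, rfl⟩ | ⟨e, he, rfl⟩) <;> exact he
  · rw [Set.disjoint_left]
    rintro _ ⟨e, -, rfl⟩ ⟨e', -, heq⟩
    induction e with | _ a b
    induction e' with | _ x y
    simp [Sym2.map_mk] at heq

lemma IsRGraph.ncard_isLonely_expand_map_inl (hG : IsRGraph G 3) :
    {e : Sym2 {w : V // w ≠ v} | IsLonely (expand G v) (e.map .inl)}.ncard =
      {e | (IsLonely G e ∧ v ∉ e) ∧ joinsThrough G v e = ∅}.ncard := by
  rw [← Set.ncard_image_of_injective _ (Sym2.map.injective Subtype.val_injective)]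
  have isLonely_iff (a b : {w : V // w ≠ v}) : IsLonely (expand G v) s(.inl a, .inl b) ↔
      IsLonely G s(a, b) ∧ joinsThrough G v s(a, b) = ∅ := by
    by_cases hab : G.Adj a b
    · exact hG.isLonely_expand_mk_iff hab hab.ne
    · exact iff_of_false (fun h ↦ hab h.1) fun h ↦ hab h.1.1
  congr
  ext e
  constructor
  · rintro ⟨e, he, rfl⟩
    induction e with | _ a b
    obtain ⟨hlonely, hjoins⟩ := (isLonely_iff a b).mp he
    exact ⟨⟨hlonely, by simp [a.2.symm, b.2.symm]⟩, hjoins⟩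
  · rintro ⟨⟨he, hv⟩, hjoins⟩
    induction e with | _ a b
    rw [Sym2.mem_iff, not_or] at hv
    exact ⟨s(⟨a, Ne.symm hv.1⟩, ⟨b, Ne.symm hv.2⟩), (isLonely_iff _ _).mpr ⟨he, hjoins⟩, rfl⟩

end Counting

end LonelyEdges

theorem mainTheorem5_general {V : Type*} [Fintype V] (G : SimpleGraph V) [DecidableRel G.Adj]
    (hcubic : G.IsRegularOfDegree 3) (hbridge : ∀ e ∈ G.edgeSet, ¬ G.IsBridge e) (v : V) :
    (LonelyEdges.lonelyCount (LonelyEdges.expand G v) : ℤ) =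
      (LonelyEdges.lonelyCount G : ℤ) - (LonelyEdges.joinLonelyCount G v : ℤ) := by
  classical
  have hG := LonelyEdges.isRGraph_three_of_forall_not_isBridge hcubic hbridge
  rw [LonelyEdges.lonelyCount_eq_add G v, hG.lonelyCount_expand, hG.ncard_isLonely_expand_map_inl,
    LonelyEdges.ncard_isLonely_expand_map_inr (hG.ncard_neighborSet v),
    LonelyEdges.ncard_isLonely_mem]
  push_cast
  ring

theorem mainTheorem5 {V : Type*} [Fintype V] (G : SimpleGraph V) [DecidableRel G.Adj]
    (hG : LonelyEdges.ClassU G) (v : V) :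
    (LonelyEdges.lonelyCount (LonelyEdges.expand G v) : ℤ) =
      (LonelyEdges.lonelyCount G : ℤ) - (LonelyEdges.joinLonelyCount G v : ℤ) :=
  mainTheorem5_general G hG.cubic (fun _ he ↦ hG.threeConnected.not_isBridge he) v
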